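/- For $g\in L^2(\mathbb R)$ and $\alpha,\beta>0$, the Gabor system $\mathcal G(g,\alpha,\beta)=\{e^{2\pi i\beta l\,\cdot}\,g(\cdot-\alpha k): k,l\in\mathbb Z\}$ is called a frame if there exist $A,B>0$ such that $$A\|f\|_2^2\le\sum_{k,l\in\mathbb Z}\bigl|\langle f, e^{2\pi i\beta l\,\cdot}g(\cdot-\alpha k)\rangle\bigr|^2\le B\|f\|_2^2\qquad\text{for all } f\in L^2(\mathbb R).$$ The Feichtinger algebra $M^1(\mathbb R)$ consists of all $g\in L^2(\mathbb R)$ whose short-time Fourier transform with Gaussian window, $V_\varphi g(x,\omega)=\int_{\mathbb R} g(t)\,\overline{\varphi(t-x)}\,e^{-2\pi i\omega t}\,dt$ with $\varphi(t)=e^{-\pi t^2}$, is integrable on $\mathbb R^2$. **Proposition.** Assume that $g\in M^1(\mathbb R)$ generates a partition of unity, i.e. $\sum_{s\in\mathbb Z}g(x-s)=1$ for all $x\in\mathbb R$. Let $m,n,r\in\mathbb N$ and $j\in\{1,\dots,r-1\}$ be such that $(r-1)m+1<rn+j<rm$ and $rn+j$ and $rm$ are relatively prime. If $\alpha=\frac1m$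 and $\beta=n+\frac jr$, then $\mathcal G(g,\alpha,\beta)$ is not a frame. -/

import Mathlib

open MeasureTheory

noncomputable section

/-- The Gaussian window `φ(t) = exp(-π t²)`. -/
def gaussianWindow (t : ℝ) : ℂ := Complex.exp (-(Real.pi : ℂ) * (t : ℂ) ^ 2)

/-- The short-time Fourier transform
`V_φ f (x, ω) = ∫ f(t) conj(φ(t - x)) exp(-2π i ω t) dt`. -/
def stft (φ f : ℝ → ℂ) (x ω : ℝ) : ℂ :=
  ∫ t : ℝ, f t * (starRingEnd ℂ) (φ (t - x)) *
    Complex.exp (-(2 * (Real.pi : ℂ) * Complex.I * (ω : ℂ) * (t : ℂ)))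

/-- The Feichtinger algebra `M¹(ℝ)`: square-integrable functions whose short-time Fourier transform
with respect to the Gaussian is integrable on the time-frequency plane `ℝ × ℝ`.
Membership depends only on the almost everywhere class of `f`; every representative is allowed,
in particular the continuous one. -/
structure IsFeichtinger (f : ℝ → ℂ) : Prop where
  memLp : MemLp f 2 volume
  integrable_stft : Integrable (fun z : ℝ × ℝ => stft gaussianWindow f z.1 z.2)
    (volume : Measure (ℝ × ℝ))

/-- The integer translates of `g` form a partition of unity: `∑_{s ∈ ℤ} g(x - s) = 1` for all `x`
(the series converging unconditionally). -/
def IsPartitionOfUnityByTranslates (g : ℝ → ℂ) : Prop :=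
  ∀ x : ℝ, HasSum (fun s : ℤ => g (x - (s : ℝ))) 1

/-- The element `t ↦ exp(2π i β l t) g(t - α k)` of the Gabor system `𝒢(g, α, β)`. -/
def gaborElement (g : ℝ → ℂ) (α β : ℝ) (k l : ℤ) (t : ℝ) : ℂ :=
  Complex.exp (2 * (Real.pi : ℂ) * Complex.I * (β : ℂ) * (l : ℂ) * (t : ℂ)) * g (t - α * (k : ℝ))

/-- The inner product `⟨f, h⟩ = ∫ f(t) conj(h(t)) dt` of square-integrable functions. -/
def innerL2 (f h : ℝ → ℂ) : ℂ := ∫ t : ℝ, f t * (starRingEnd ℂ) (h t)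

/-- For `g ∈ L²(ℝ)` and `α, β > 0`: the Gabor system `𝒢(g, α, β)` is a frame for `L²(ℝ)`.
Summability of the frame coefficients is part of the upper bound. -/
def IsGaborFrame (g : ℝ → ℂ) (α β : ℝ) : Prop :=
  ∃ A B : ℝ, 0 < A ∧ 0 < B ∧ ∀ f : ℝ → ℂ, MemLp f 2 volume →
    Summable (fun kl : ℤ × ℤ => ‖innerL2 f (gaborElement g α β kl.1 kl.2)‖ ^ 2) ∧
    A * ∫ t : ℝ, ‖f t‖ ^ 2 ≤ ∑' kl : ℤ × ℤ, ‖innerL2 f (gaborElement g α β kl.1 kl.2)‖ ^ 2 ∧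
    ∑' kl : ℤ × ℤ, ‖innerL2 f (gaborElement g α β kl.1 kl.2)‖ ^ 2 ≤ B * ∫ t : ℝ, ‖f t‖ ^ 2

end

/-!
Write `p = r n + j`, `α = 1 / m`, `β = p / r`. For a function `f` and `x ∈ [0, 1 / β)`, Parseval's
identity on `[0, 1 / β]` turns the sum over the modulations `l` of the squared frame coefficients
into `(1 / β) ∫ |∑_s f (x + s / β) conj (g (x + s / β - k / m))|² dx`. Hence the frame inequality
concerns, for almost every `x`, the infinite matrix `g (x + s r / p - k / m)` with rows `k` and
columns `s`. On a vector `c` that is `p`-periodic in `s`, this matrix acts through the finite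
matrix `G (x + s r / p - k / m)`, `s < p`, `k < r m`, where `G y = ∑_i g (y + r i)` is the
periodization.

The partition of unity says `∑_{i < r} G (y - i) = 1`, so the rows in each residue class modulo `m`
add up to the all-ones row. The `r m` rows thus span at most `(r - 1) m + 1 < p` dimensions, and
some nonzero `p`-periodic `c` is annihilated (`exists_kernel_of_rows_sum_one`). Truncating `c` to
`N` periods leaves only boundary terms, whose total is `o(N)` because `g` has summable local bounds
(`sq_norm_fiberSum_le`, `tendsto_totalDefect_div`), whereas the squared norm of the truncation is
at least `N`. This contradicts the lower frame bound.

Two points of measure theory enter. The vector `c` depends on `x`; instead of selecting it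
measurably, one fixes `x₀` and keeps `c` on a set of positive measure where the finite matrix
varies by less than a small `η` (`exists_measurableSet_dist_lt`), at the cost of an error `N η`.
And the summable local bounds of a function in `M¹(ℝ)` come from Fourier inversion in the frequency
variable of the short-time Fourier transform (`IsFeichtinger.exists_summable_bound`).
-/

noncomputable section

/-! ### Local bounds for functions in the Feichtinger algebra -/

open FourierTransform in
/-- An integrable function with integrable Fourier transform is almost everywhere bounded by the
`L¹` norm of its Fourier transform; no continuity is needed. -/
theorem ae_norm_le_integral_norm_fourier {f : ℝ → ℂ} (hf : Integrable f)
    (hf' : Integrable (𝓕 f)) : ∀ᵐ t, ‖f t‖ ≤ ∫ ω, ‖(𝓕 f) ω‖ := by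
  have hnorm : ∀ t, ‖(𝓕⁻ (𝓕 f)) t‖ ≤ ∫ ω, ‖(𝓕 f) ω‖ := fun t => by
    rw [Real.fourierInv_eq]
    refine (norm_integral_le_integral_norm _).trans_eq ?_
    simp
  have hcont : Continuous (𝓕⁻ (𝓕 f)) := by
    have h : Continuous (𝓕 (𝓕 f)) := VectorFourier.fourierIntegral_continuous (μ := volume)
      Real.continuous_fourierChar (L := innerₗ ℝ) continuous_inner hf'
    have h' : 𝓕⁻ (𝓕 f) = fun t => 𝓕 (𝓕 f) (-t) := funext fun t =>
      Real.fourierInv_eq_fourier_neg _ _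
    rw [h']
    exact h.comp continuous_neg
  have flip : ∀ u v : ℝ → ℂ, Integrable u → Integrable v →
      ∫ ω, (𝓕 u) ω • v ω = ∫ t, u t • (𝓕 v) t := fun u v hu hv => by
    simpa using! VectorFourier.integral_fourierIntegral_smul_eq_flip (L := innerₗ ℝ)
      Real.continuous_fourierChar continuous_inner hu hv
  have key : ∀ᵐ t, f t = (𝓕⁻ (𝓕 f)) t := by
    refine ae_eq_of_integral_contDiff_smul_eq hf.locallyIntegrable
      hcont.locallyIntegrable fun ψ hψ hψc => ?_
    have hψc' : HasCompactSupport fun t => (ψ t : ℂ) :=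
      hψc.comp_left (g := fun x : ℝ => (x : ℂ)) (by simp)
    have hψ' : ContDiff ℝ ((⊤ : ℕ∞) : WithTop ℕ∞) fun t => (ψ t : ℂ) :=
      Complex.ofRealCLM.contDiff.comp hψ
    let Ψ : SchwartzMap ℝ ℂ := hψc'.toSchwartzMap hψ'
    have hΨ : ∀ t, Ψ t = (ψ t : ℂ) := fun t => rfl
    have h1 : ∫ ω, (𝓕 f) ω • (𝓕⁻ Ψ) ω = ∫ t, f t • Ψ t := by
      rw [flip f (𝓕⁻ Ψ : SchwartzMap ℝ ℂ) hf (𝓕⁻ Ψ : SchwartzMap ℝ ℂ).integrable,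
        ← SchwartzMap.fourier_coe, FourierTransform.fourier_fourierInv_eq]
    have h2 : ∫ ω, (𝓕⁻ (𝓕 f)) ω • Ψ ω = ∫ t, (𝓕 f) t • (𝓕⁻ Ψ) t := by
      have h := flip (𝓕 f) (fun t => Ψ (-t)) hf' Ψ.integrable.comp_neg
      rw [SchwartzMap.fourierInv_coe]
      simp_rw [Real.fourierInv_eq_fourier_comp_neg (⇑Ψ), Real.fourierInv_eq_fourier_neg (𝓕 f)]
      rw [← h, ← integral_neg_eq_self]
      simp
    have h12 : ∫ t, f t • Ψ t = ∫ t, (𝓕⁻ (𝓕 f)) t • Ψ t := by rw [← h1, h2]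
    simpa only [hΨ, smul_eq_mul, Complex.real_smul, mul_comm] using h12
  filter_upwards [key] with t ht
  rw [ht]
  exact hnorm t

theorem memLp_gaussianWindow_sub (x : ℝ) :
    MemLp (fun t => (starRingEnd ℂ) (gaussianWindow (t - x))) 2 volume := by
  have hn : ∀ t, ‖gaussianWindow t‖ = Real.exp (-Real.pi * t ^ 2) := fun t => by
    rw [gaussianWindow, Complex.norm_exp]
    norm_cast
  have hc : Continuous gaussianWindow := by unfold gaussianWindow; fun_prop
  have h0 : MemLp gaussianWindow 2 volume := by
    rw [memLp_two_iff_integrable_sq_norm hc.aestronglyMeasurable]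
    refine (integrable_exp_neg_mul_sq (b := 2 * Real.pi) (by positivity)).congr
      (.of_forall fun t => ?_)
    simp only [hn, ← Real.exp_nat_mul]
    congr 1
    push_cast
    ring
  exact (h0.comp_measurePreserving (measurePreserving_sub_right volume x)).star

/-- For almost every `x`, Fourier inversion of `t ↦ g t * φ (t - x)` bounds `g` near `x` by the
`L¹` norm of the slice `V_φ g (x, ·)`. -/
theorem IsFeichtinger.ae_ae_norm_mul_le {g : ℝ → ℂ} (hg : IsFeichtinger g) :
    ∀ᵐ x : ℝ, ∀ᵐ t : ℝ, ‖g t‖ * Real.exp (-Real.pi * (t - x) ^ 2) ≤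
      ∫ ω, ‖stft gaussianWindow g x ω‖ := by
  filter_upwards [hg.integrable_stft.prod_right_ae] with x hx
  have hF : FourierTransform.fourier
      (fun t => g t * (starRingEnd ℂ) (gaussianWindow (t - x))) =
      stft gaussianWindow g x := by
    ext ω
    rw [Real.fourier_eq', stft]
    congr 1
    ext t
    rw [smul_eq_mul, mul_comm]
    congr 2
    simp
    ring
  have h := ae_norm_le_integral_norm_fourier (hg.memLp.integrable_mul (memLp_gaussianWindow_sub x))
    (by simp only [Pi.mul_def]; rwa [hF])
  simp only [Pi.mul_def, hF] at h
  filter_upwards [h] with t ht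
  refine le_of_eq_of_le ?_ ht
  rw [norm_mul, RCLike.norm_conj, gaussianWindow, Complex.norm_exp]
  norm_cast

/-- A function in `M¹(ℝ)` is essentially bounded on intervals around the points of `Rℤ`, with
summable bounds: `M¹(ℝ)` embeds in the Wiener amalgam space `W(L^∞, ℓ¹)`. -/
theorem IsFeichtinger.exists_summable_bound {g : ℝ → ℂ} (hg : IsFeichtinger g) {R : ℝ}
    (hR : 0 < R) : ∃ d : ℤ → ℝ, Summable d ∧ (∀ i, 0 ≤ d i) ∧
      ∀ᵐ t : ℝ, ∀ i : ℤ, |t - R * i| ≤ R → ‖g t‖ ≤ d i := by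
  set h : ℝ → ℝ := fun x => ∫ ω, ‖stft gaussianWindow g x ω‖ with hh
  have hint : Integrable h := Integrable.integral_norm_prod_left hg.integrable_stft
  have hh0 : ∀ x, 0 ≤ h x := fun x => integral_nonneg fun ω => norm_nonneg _
  let I : ℤ → Set ℝ := fun i => Set.Ioc (i • R) ((i + 1) • R)
  have hvol : ∀ i, volume (I i) = ENNReal.ofReal R := fun i => by
    simp only [I, Real.volume_Ioc, zsmul_eq_mul]
    congr 1
    push_cast
    ring
  have hsum : Summable fun i => ∫ x in I i, h x :=
    (hasSum_integral_iUnion (fun i => measurableSet_Ioc) (Set.pairwise_disjoint_Ioc_zsmul R)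
      hint.integrableOn).summable
  refine ⟨fun i => Real.exp (Real.pi * (2 * R) ^ 2) * (R⁻¹ * ∫ x in I i, h x),
    (hsum.mul_left _).mul_left _, fun i => ?_, ?_⟩
  · have : 0 ≤ ∫ x in I i, h x := integral_nonneg hh0
    positivity
  rw [ae_all_iff]
  intro i
  have hN := hg.ae_ae_norm_mul_le
  have hfin : IsFiniteMeasure (volume.restrict (I i)) := ⟨by simp [hvol]⟩
  have hne : volume.restrict (I i) ≠ 0 := by
    rw [Ne, Measure.restrict_eq_zero, hvol]
    simpa using hR
  obtain ⟨x, hxN, hx⟩ := exists_notMem_null_le_average hne hint.integrableOn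
    (N := {x | ¬ (x ∈ I i ∧ ∀ᵐ t : ℝ, ‖g t‖ * Real.exp (-Real.pi * (t - x) ^ 2) ≤ h x)}) (by
      rw [← ae_iff]
      filter_upwards [ae_restrict_mem measurableSet_Ioc, ae_restrict_of_ae hN] with x h1 h2
      exact ⟨h1, h2⟩)
  rw [Set.mem_ofPred_eq, not_not] at hxN
  rw [setAverage_eq, measureReal_def, hvol, ENNReal.toReal_ofReal hR.le, smul_eq_mul] at hx
  filter_upwards [hxN.2] with t ht hti
  have hxi := hxN.1
  simp only [I, zsmul_eq_mul, Set.mem_Ioc] at hxi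
  push_cast at hxi
  have hsq : (t - x) ^ 2 ≤ (2 * R) ^ 2 := by
    rw [abs_le] at hti
    exact sq_le_sq' (by linarith) (by linarith)
  have hexp : Real.exp (-Real.pi * (2 * R) ^ 2) ≤ Real.exp (-Real.pi * (t - x) ^ 2) := by
    rw [Real.exp_le_exp, neg_mul, neg_mul, neg_le_neg_iff]
    gcongr
  have h3 : ‖g t‖ * Real.exp (-Real.pi * (2 * R) ^ 2) ≤ R⁻¹ * ∫ x in I i, h x :=
    (mul_le_mul_of_nonneg_left hexp (norm_nonneg _)).trans (ht.trans hx)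
  calc ‖g t‖ = Real.exp (Real.pi * (2 * R) ^ 2) *
        (‖g t‖ * Real.exp (-Real.pi * (2 * R) ^ 2)) := by
        rw [mul_left_comm, ← Real.exp_add]
        simp
    _ ≤ _ := by gcongr

/-! ### A kernel vector from the partition of unity -/

/-- If the rows `R k`, `k < r * m`, sum to the all-ones row along every residue class modulo `m`,
then they span at most `(r - 1) * m + 1` dimensions, hence have a common kernel vector `c` as soon
as there are more columns than that. The vector is normalised in the supremum norm. -/
theorem exists_kernel_of_rows_sum_one {p m r : ℕ} (hr : 0 < r) (hp : (r - 1) * m + 1 < p)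
    (R : ℕ → Fin p → ℂ)
    (hR : ∀ k < m, ∀ s, ∑ i ∈ Finset.range r, R (k + m * i) s = 1) :
    ∃ c : Fin p → ℂ, (∀ s, ‖c s‖ ≤ 1) ∧ (∃ s, ‖c s‖ = 1) ∧
      ∀ k < r * m, ∑ s, c s * R k s = 0 := by
  let T : (Fin p → ℂ) →ₗ[ℂ] (Option (Fin ((r - 1) * m)) → ℂ) :=
    Matrix.mulVecLin (Matrix.of fun o s => o.elim 1 fun k => R k s)
  have hker : T.ker ≠ ⊥ := LinearMap.ker_ne_bot_of_finrank_lt (by simpa using hp)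
  obtain ⟨v, hv, hv0⟩ := (Submodule.ne_bot_iff _).1 hker
  have hT : ∀ o, T v o = 0 := fun o => by rw [LinearMap.mem_ker.1 hv]; rfl
  have hnone : ∑ s, v s = 0 := by
    simpa [T, Matrix.mulVec, dotProduct] using hT none
  have hsome : ∀ k < (r - 1) * m, ∑ s, v s * R k s = 0 := fun k hk => by
    simpa [T, Matrix.mulVec, dotProduct, mul_comm] using hT (some ⟨k, hk⟩)
  have hrow : ∀ k < r * m, ∑ s, v s * R k s = 0 := by
    intro k hk
    rcases lt_or_ge k ((r - 1) * m) with h | h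
    · exact hsome k h
    -- A row of the last block is the all-ones row minus rows of the earlier blocks
    obtain ⟨r', rfl⟩ : ∃ r', r = r' + 1 := ⟨r - 1, by omega⟩
    simp only [Nat.add_sub_cancel] at h hsome
    obtain ⟨k', rfl⟩ := Nat.exists_eq_add_of_le h
    have hk' : k' < m := by rw [add_mul, one_mul] at hk; omega
    have h1 : ∑ s, v s * ∑ i ∈ Finset.range (r' + 1), R (k' + m * i) s = 0 := by
      simp [hR k' hk', hnone]
    simp only [Finset.mul_sum] at h1
    rw [Finset.sum_comm, Finset.sum_range_succ, Finset.sum_eq_zero, zero_add] at h1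
    · rwa [add_comm, mul_comm r' m]
    · intro i hi
      refine hsome _ ?_
      have : m * (i + 1) ≤ m * r' := Nat.mul_le_mul_left m (Finset.mem_range.1 hi)
      rw [mul_comm r' m]
      rw [mul_add] at this
      omega
  have : Nonempty (Fin p) := ⟨⟨0, by omega⟩⟩
  have hpos : 0 < ‖v‖ := norm_pos_iff.2 hv0
  refine ⟨fun s => (‖v‖⁻¹ : ℝ) * v s, fun s => ?_, ?_, fun k hk => ?_⟩
  · simpa [inv_mul_le_iff₀ hpos] using norm_le_pi_norm v s
  · obtain ⟨s, hs⟩ := Finite.exists_max fun s => ‖v s‖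
    have hs' : ‖v s‖ = ‖v‖ :=
      le_antisymm (norm_le_pi_norm v s) ((pi_norm_le_iff_of_nonneg (norm_nonneg _)).2 hs)
    exact ⟨s, by simp [hs', hpos.ne']⟩
  · simp only [mul_assoc, ← Finset.mul_sum, hrow k hk, mul_zero]

/-- A measurable map into a separable space is, up to `η`, constant on some subset of positive
measure of any given set of positive measure. -/
theorem exists_measurableSet_dist_lt {α X : Type*} [MeasurableSpace α] {μ : Measure α}
    [PseudoMetricSpace X] [TopologicalSpace.SeparableSpace X] [MeasurableSpace X]
    [OpensMeasurableSpace X] {F : α → X} (hF : Measurable F) {S : Set α} (hS : MeasurableSet S)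
    (hS0 : μ S ≠ 0) {η : ℝ} (hη : 0 < η) :
    ∃ E ⊆ S, MeasurableSet E ∧ μ E ≠ 0 ∧ ∀ x ∈ E, ∀ y ∈ E, dist (F x) (F y) < η := by
  obtain ⟨x₀, -⟩ := nonempty_of_measure_ne_zero hS0
  have : Nonempty X := ⟨F x₀⟩
  by_contra! hcon
  refine hS0 (measure_mono_null (t := ⋃ n : ℕ,
    S ∩ F ⁻¹' Metric.ball (TopologicalSpace.denseSeq X n) (η / 2)) (fun x hx => ?_) ?_)
  · obtain ⟨n, hn⟩ := (TopologicalSpace.denseRange_denseSeq X).exists_dist_lt (F x) (half_pos hη)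
    exact Set.mem_iUnion.2 ⟨n, hx, hn⟩
  · refine measure_iUnion_null fun n => by_contra fun h0 => ?_
    obtain ⟨x, hx, y, hy, hxy⟩ := hcon _ Set.inter_subset_left
      (hS.inter (hF Metric.isOpen_ball.measurableSet)) h0
    have h1 := Metric.mem_ball.1 hx.2
    have h2 := Metric.mem_ball'.1 hy.2
    linarith [dist_triangle (F x) (TopologicalSpace.denseSeq X n) (F y)]

/-- The periodization `y ↦ ∑_{i ∈ ℤ} g (y + ρ i)`. -/
def periodization (ρ : ℝ) (g : ℝ → ℂ) (y : ℝ) : ℂ := ∑' i : ℤ, g (y + ρ * i)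

theorem summable_periodization {g : ℝ → ℂ} {ρ : ℝ} (hρ : 0 < ρ) {d : ℤ → ℝ} (hd : Summable d)
    (hb : ∀ t : ℝ, ∀ i : ℤ, |t - ρ * i| ≤ ρ → ‖g t‖ ≤ d i) (y : ℝ) :
    Summable fun i : ℤ => g (y + ρ * i) := by
  refine Summable.of_norm_bounded ((Equiv.addRight ⌊y / ρ⌋).summable_iff.2 hd)
    fun i => hb _ _ ?_
  have h1 := (le_div_iff₀ hρ).1 (Int.floor_le (y / ρ))
  have h2 := (div_lt_iff₀ hρ).1 (Int.lt_floor_add_one (y / ρ))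
  simp only [Equiv.coe_addRight, Int.cast_add]
  rw [abs_le]
  constructor <;> linarith

theorem measurable_periodization {g : ℝ → ℂ} (hg : Measurable g) {ρ : ℝ}
    (h : ∀ y, Summable fun i : ℤ => g (y + ρ * i)) : Measurable (periodization ρ g) :=
  (StronglyMeasurable.hasSum (f := fun (i : ℤ) y => g (y + ρ * i))
    (fun _ => (hg.comp (measurable_id.add_const _)).stronglyMeasurable)
    fun y => (h y).hasSum).measurable

theorem sum_range_periodization_sub {g : ℝ → ℂ} {r : ℕ} (hr : 0 < r) {y : ℝ} {a : ℂ}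
    (h : HasSum (fun s : ℤ => g (y - s)) a) :
    ∑ i ∈ Finset.range r, periodization r g (y - i) = a := by
  have : NeZero r := ⟨hr.ne'⟩
  have h1 := ((Equiv.prodComm _ _).trans (Int.divModEquiv r).symm).hasSum_iff.2 h
  rw [← h1.tsum_eq, h1.summable.tsum_prod, tsum_fintype, Finset.sum_range]
  refine Finset.sum_congr rfl fun i _ => ?_
  rw [periodization, ← (Equiv.neg ℤ).tsum_eq]
  refine tsum_congr fun κ => congrArg g ?_
  simp
  ring

/-- A partition of unity makes the `r * m` rows of the matrix
`periodization r g (x + s * (r / p) - k / m)` dependent enough to have a common kernel vector; by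
almost constancy, one vector nearly annihilates the matrix on a set of positive measure. -/
theorem exists_approximate_kernel {g : ℝ → ℂ} (hg : Measurable g) {p m r : ℕ} (hr : 0 < r)
    (hm : 0 < m) (hp : (r - 1) * m + 1 < p)
    (hs : ∀ y, Summable fun i : ℤ => g (y + r * i))
    (hpu : ∀ᵐ x : ℝ, HasSum (fun s : ℤ => g (x - s)) 1) {η : ℝ} (hη : 0 < η) :
    ∃ E ⊆ Set.Ioo 0 (r / p : ℝ), MeasurableSet E ∧ volume E ≠ 0 ∧
      ∃ c : Fin p → ℂ, (∀ s, ‖c s‖ ≤ 1) ∧ (∃ s, ‖c s‖ = 1) ∧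
        ∀ x ∈ E, ∀ k < r * m,
          ‖∑ s, c s * periodization r g (x + s * (r / p) - k / m)‖ ≤ η := by
  have hp0 : (0 : ℝ) < p := by exact_mod_cast (Nat.zero_lt_of_lt hp)
  have hr0 : (0 : ℝ) < r := by exact_mod_cast hr
  have hm0 : (0 : ℝ) < m := by exact_mod_cast hm
  let F : ℝ → Fin (r * m) → Fin p → ℂ := fun x k s =>
    periodization r g (x + s * (r / p) - k / m)
  have hF : Measurable F := by
    have := measurable_periodization hg hs
    refine measurable_pi_lambda _ fun k => measurable_pi_lambda _ fun s => this.comp ?_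
    fun_prop
  obtain ⟨E, hEL, hE, hE0, hdist⟩ := exists_measurableSet_dist_lt (μ := volume) hF
    (S := Set.Ioo 0 (r / p : ℝ)) measurableSet_Ioo (by simp; positivity) (div_pos hη hp0)
  have hpu' : ∀ᵐ x : ℝ, ∀ (s : Fin p) (k : ℕ),
      HasSum (fun i : ℤ => g (x + (s * (r / p) - k / m) - i)) 1 := by
    simp only [ae_all_iff]
    intro s k
    exact (measurePreserving_add_right volume _).quasiMeasurePreserving.ae hpu
  obtain ⟨x₀, hx₀E, hx₀⟩ : ∃ x₀ ∈ E, ∀ (s : Fin p) (k : ℕ),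
      HasSum (fun i : ℤ => g (x₀ + (s * (r / p) - k / m) - i)) 1 := by
    have := (ae_restrict_of_ae (s := E) hpu').and (ae_restrict_mem hE)
    have hne : (ae (volume.restrict E)).NeBot := by
      rw [ae_neBot, Ne, Measure.restrict_eq_zero]
      exact hE0
    obtain ⟨x₀, h1, h2⟩ := this.exists
    exact ⟨x₀, h2, h1⟩
  obtain ⟨c, hc, hc1, hker⟩ := exists_kernel_of_rows_sum_one hr hp
    (fun k s => periodization r g (x₀ + s * (r / p) - k / m)) fun k _ s => by
      rw [← sum_range_periodization_sub hr (hx₀ s k)]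
      refine Finset.sum_congr rfl fun i _ => congrArg _ ?_
      push_cast
      field_simp
      ring
  refine ⟨E, hEL, hE, hE0, c, hc, hc1, fun x hx k hk => ?_⟩
  calc ‖∑ s, c s * periodization r g (x + s * (r / p) - k / m)‖
      = ‖∑ s, c s * (F x ⟨k, hk⟩ s - F x₀ ⟨k, hk⟩ s)‖ := by
        simp only [mul_sub, Finset.sum_sub_distrib, F, hker k hk, sub_zero]
    _ ≤ ∑ _s : Fin p, η / p := norm_sum_le_of_le _ fun s _ => by
        rw [norm_mul, ← dist_eq_norm]
        have h1 : dist (F x ⟨k, hk⟩ s) (F x₀ ⟨k, hk⟩ s) ≤ dist (F x) (F x₀) :=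
          (dist_le_pi_dist _ _ s).trans (dist_le_pi_dist (F x) (F x₀) ⟨k, hk⟩)
        calc _ ≤ 1 * (η / p) := mul_le_mul (hc s) (h1.trans (hdist x hx x₀ hx₀E).le)
              dist_nonneg zero_le_one
          _ = η / p := one_mul _
    _ = η := by
        rw [Finset.sum_const, Finset.card_univ, Fintype.card_fin, nsmul_eq_mul,
          mul_div_cancel₀ _ hp0.ne']

/-! ### Truncation of sums over the integers -/

/-- The indicator function of the window `{0, …, N - 1}` in `ℤ`. -/
def window (N : ℕ) (κ : ℤ) : ℝ := if 0 ≤ κ ∧ κ < N then 1 else 0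

theorem window_nonneg (N : ℕ) (κ : ℤ) : 0 ≤ window N κ := by
  unfold window; split_ifs <;> norm_num

theorem abs_window_sub_le_one (N : ℕ) (κ κ' : ℤ) : |window N κ - window N κ'| ≤ 1 := by
  unfold window; split_ifs <;> norm_num

theorem sum_window_le (N : ℕ) (K : Finset ℤ) : ∑ κ ∈ K, window N κ ≤ N := by
  simp only [window, Finset.sum_ite, Finset.sum_const_zero, add_zero, Finset.sum_const,
    nsmul_eq_mul, mul_one]
  have : (K.filter fun κ : ℤ => 0 ≤ κ ∧ κ < N).card ≤ (Finset.Ico (0 : ℤ) N).card :=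
    Finset.card_le_card fun κ hκ => Finset.mem_Ico.2 (Finset.mem_filter.1 hκ).2
  exact_mod_cast this.trans_eq (by simp)

/-- A shift by `j` moves at most `min (4 |j|) (2 N)` points across the boundary of the window. -/
theorem sum_abs_window_shift_sub_le (N : ℕ) (j : ℤ) (K : Finset ℤ) :
    ∑ κ ∈ K, |window N (j + κ) - window N κ| ≤ min (4 * |(j : ℝ)|) (2 * N) := by
  have key : ∀ S : Finset ℤ, (∀ κ, κ ∉ S → window N (j + κ) = window N κ) →
      ∑ κ ∈ K, |window N (j + κ) - window N κ| ≤ S.card := fun S hS => by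
    calc _ ≤ ∑ κ ∈ K, if κ ∈ S then (1 : ℝ) else 0 := Finset.sum_le_sum fun κ _ => by
          split_ifs with h
          · exact abs_window_sub_le_one _ _ _
          · simp [hS κ h]
      _ = (K.filter (· ∈ S)).card := by rw [Finset.sum_boole]
      _ ≤ S.card := by
        exact_mod_cast Finset.card_le_card fun κ hκ => (Finset.mem_filter.1 hκ).2
  refine le_min ?_ ?_
  · refine (key (Finset.Ico (-|j|) |j| ∪ Finset.Ico (N - |j|) (N + |j|)) fun κ hκ => ?_).trans ?_
    · simp only [Finset.mem_union, Finset.mem_Ico, not_or, not_and, not_lt] at hκ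
      have h1 := le_abs_self j
      have h2 := neg_abs_le j
      unfold window
      congr 1
      apply propext
      constructor <;> intro h <;> constructor <;> grind
    · have h := Finset.card_union_le (Finset.Ico (-|j|) |j|) (Finset.Ico (N - |j|) (N + |j|))
      have h4 : ((Finset.Ico (-|j|) |j| ∪ Finset.Ico (N - |j|) (N + |j|)).card : ℤ) ≤ 4 * |j| := by
        simp only [Int.card_Ico] at h
        have := abs_nonneg j
        omega
      exact_mod_cast h4
  · refine (key (Finset.Ico 0 N ∪ Finset.Ico (-j) (N - j)) fun κ hκ => ?_).trans ?_
    · simp only [Finset.mem_union, Finset.mem_Ico, not_or] at hκ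
      unfold window
      rw [if_neg (by omega), if_neg (by omega)]
    · have h := Finset.card_union_le (Finset.Ico (0 : ℤ) N) (Finset.Ico (-j) (N - j))
      simp only [Int.card_Ico] at h
      have h2 : (Finset.Ico (0 : ℤ) N ∪ Finset.Ico (-j) (N - j)).card ≤ 2 * N := by omega
      exact_mod_cast h2

/-- The error bound for replacing a sum over the window, shifted by `κ`, by the sum over `ℤ` (if
`κ` lies in the window) or by `0` (if not), for terms dominated by `d`. -/
def truncationDefect (d : ℤ → ℝ) (N : ℕ) (κ : ℤ) : ℝ :=
  ∑' j, d j * |window N (j + κ) - window N κ|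

/-- A bound for the sum of all the truncation defects; it grows slower than `N`. -/
def totalDefect (d : ℤ → ℝ) (N : ℕ) : ℝ := ∑' j : ℤ, d j * min (4 * |(j : ℝ)|) (2 * N)

theorem summable_mul_abs_window {d : ℤ → ℝ} (hd : Summable d) (hd0 : ∀ i, 0 ≤ d i)
    (N : ℕ) (κ : ℤ) : Summable fun j => d j * |window N (j + κ) - window N κ| :=
  hd.of_nonneg_of_le (fun j => mul_nonneg (hd0 j) (abs_nonneg _)) fun j =>
    mul_le_of_le_one_right (hd0 j) (abs_window_sub_le_one _ _ _)

theorem truncationDefect_nonneg {d : ℤ → ℝ} (hd0 : ∀ i, 0 ≤ d i) (N : ℕ) (κ : ℤ) :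
    0 ≤ truncationDefect d N κ :=
  tsum_nonneg fun j => mul_nonneg (hd0 j) (abs_nonneg _)

theorem norm_sum_range_sub_window_mul_tsum_le {d : ℤ → ℝ} (hd : Summable d)
    (hd0 : ∀ i, 0 ≤ d i) {a : ℤ → ℂ} (ha : ∀ j, ‖a j‖ ≤ d j) (N : ℕ) (κ : ℤ) :
    ‖∑ i ∈ Finset.range N, a (i - κ) - window N κ * ∑' j, a j‖ ≤ truncationDefect d N κ := by
  have has : Summable a := Summable.of_norm_bounded hd ha
  -- the truncated sum as a sum over all integers
  have h1 : HasSum (fun j => (window N (j + κ) : ℂ) * a j) (∑ i ∈ Finset.range N, a (i - κ)) := by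
    have h2 : HasSum (fun i : ℤ => (window N i : ℂ) * a (i - κ))
        (∑ i ∈ (Finset.range N).map Nat.castEmbedding, (window N i : ℂ) * a (i - κ)) := by
      refine hasSum_sum_of_ne_finset_zero fun i hi => ?_
      have : ¬ (0 ≤ i ∧ i < N) := fun h => hi <| by
        rw [Finset.mem_map]
        exact ⟨i.toNat, by simp; omega, by simp [h.1]⟩
      simp [window, this]
    rw [Finset.sum_map] at h2
    have h3 := (Equiv.addRight κ).hasSum_iff.2 h2
    convert h3 using 1
    · ext j
      simp
    · refine Finset.sum_congr rfl fun i hi => ?_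
      have : i < N := Finset.mem_range.1 hi
      simp [window, this]
  have h4 := h1.sub (has.hasSum.mul_left (window N κ : ℂ))
  rw [← h4.tsum_eq]
  refine tsum_of_norm_bounded (summable_mul_abs_window hd hd0 N κ).hasSum fun j => ?_
  rw [← sub_mul, norm_mul, mul_comm, ← Complex.ofReal_sub, Complex.norm_real, Real.norm_eq_abs]
  exact mul_le_mul_of_nonneg_right (ha j) (abs_nonneg _)

theorem summable_totalDefect {d : ℤ → ℝ} (hd : Summable d) (hd0 : ∀ i, 0 ≤ d i) (N : ℕ) :
    Summable fun j : ℤ => d j * min (4 * |(j : ℝ)|) (2 * N) :=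
  (hd.mul_right (2 * N : ℝ)).of_nonneg_of_le (fun j => mul_nonneg (hd0 j) (by positivity))
    fun j => mul_le_mul_of_nonneg_left (min_le_right _ _) (hd0 j)

theorem sum_truncationDefect_le {d : ℤ → ℝ} (hd : Summable d) (hd0 : ∀ i, 0 ≤ d i) (N : ℕ)
    (K : Finset ℤ) : ∑ κ ∈ K, truncationDefect d N κ ≤ totalDefect d N := by
  unfold truncationDefect
  rw [← Summable.tsum_finsetSum fun κ _ => summable_mul_abs_window hd hd0 N κ]
  refine Summable.tsum_le_tsum (fun j => ?_)
    (summable_sum fun κ _ => summable_mul_abs_window hd hd0 N κ) (summable_totalDefect hd hd0 N)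
  rw [← Finset.mul_sum]
  exact mul_le_mul_of_nonneg_left (sum_abs_window_shift_sub_le N j K) (hd0 j)

open Filter Topology in
theorem tendsto_totalDefect_div {d : ℤ → ℝ} (hd : Summable d) (hd0 : ∀ i, 0 ≤ d i) :
    Tendsto (fun N : ℕ => totalDefect d N / N) atTop (𝓝 0) := by
  have h := tendsto_tsum_of_dominated_convergence (𝓕 := (atTop : Filter ℕ))
    (f := fun N j => d j * min (4 * |((j : ℤ) : ℝ)|) (2 * N) / N) (g := fun _ => 0)
    (bound := fun j => d j * 2) (hd.mul_right 2) (fun j => ?_) ?_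
  · simpa only [totalDefect, tsum_div_const, tsum_zero] using h
  · refine squeeze_zero (fun N => div_nonneg (mul_nonneg (hd0 j) (by positivity)) (by positivity))
      (fun N => ?_) (tendsto_const_div_atTop_nhds_zero_nat (d j * (4 * |(j : ℝ)|)))
    gcongr
    · exact hd0 j
    · exact min_le_left _ _
  · filter_upwards [eventually_gt_atTop 0] with N hN j
    have hN' : (0 : ℝ) < N := by exact_mod_cast hN
    rw [Real.norm_of_nonneg (div_nonneg (mul_nonneg (hd0 j) (by positivity)) hN'.le),
      div_le_iff₀ hN', mul_assoc]
    exact mul_le_mul_of_nonneg_left (min_le_right _ _) (hd0 j)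

/-- Summing over `ℤ` a quantity that only depends on the quotient by `q`. -/
theorem sum_comp_ediv_le {B : ℤ → ℝ} (hB : ∀ κ, 0 ≤ B κ) {C : ℝ}
    (hC : ∀ K : Finset ℤ, ∑ κ ∈ K, B κ ≤ C) {q : ℕ} (hq : 0 < q) (K : Finset ℤ) :
    ∑ k ∈ K, B (k / q) ≤ q * C := by
  rw [Finset.sum_comp]
  calc _ ≤ ∑ κ ∈ K.image (· / (q : ℤ)), q * B κ := Finset.sum_le_sum fun κ _ => by
        rw [nsmul_eq_mul]
        refine mul_le_mul_of_nonneg_right ?_ (hB κ)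
        have : (K.filter fun k => k / (q : ℤ) = κ).card ≤
            (Finset.Ico (κ * q) (κ * q + q)).card := Finset.card_le_card fun k hk => by
          have hq' : (0 : ℤ) < q := by exact_mod_cast hq
          have h := (Finset.mem_filter.1 hk).2
          rw [Finset.mem_Ico, ← h]
          have h1 := Int.ediv_mul_add_emod k q
          have h2 := Int.emod_nonneg k hq'.ne'
          have h3 := Int.emod_lt_of_pos k hq'
          constructor <;> linarith
        exact_mod_cast this.trans_eq (by simp)
    _ ≤ q * C := by
        rw [← Finset.mul_sum]
        exact mul_le_mul_of_nonneg_left (hC _) (by positivity)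

/-! ### Fiber sums -/

/-- The fiber sum paired with the translate of `g` by `z`: the values of `g (· - z)` on the first
`N * p` points `x + (s + p * i) * (ρ / p)`, weighted with the `p`-periodic coefficients `c`. -/
def fiberSum (g : ℝ → ℂ) {p : ℕ} (ρ : ℝ) (c : Fin p → ℂ) (N : ℕ) (z x : ℝ) : ℂ :=
  ∑ i ∈ Finset.range N, ∑ s : Fin p, c s * g (x + (s * (ρ / p) + ρ * i) - z)

theorem measurable_fiberSum {g : ℝ → ℂ} (hg : Measurable g) {p : ℕ} (ρ : ℝ) (c : Fin p → ℂ)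
    (N : ℕ) (z : ℝ) : Measurable (fiberSum g ρ c N z) := by
  unfold fiberSum
  refine Finset.measurable_fun_sum _ fun i _ => Finset.measurable_fun_sum _ fun s _ => ?_
  exact (hg.comp (by fun_prop)).const_mul _

/-- With `k = k' + r m κ` and `k' < r m`, the fiber sum at `k / m` is a truncation, shifted by `κ`,
of the periodized sum at `k' / m`. That sum is at most `η` by the kernel property, so the fiber sum
is small except for `κ` near the ends of the window. One factor of the square is bounded trivially,
so that only first powers of the truncation defects have to be summed. -/
theorem sq_norm_fiberSum_le {g : ℝ → ℂ} {p m r : ℕ} (hr : 0 < r) (hm : 0 < m) (hp : 0 < p)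
    {d : ℤ → ℝ} (hd : Summable d) (hd0 : ∀ i, 0 ≤ d i)
    (hb : ∀ t : ℝ, ∀ i : ℤ, |t - r * i| ≤ r → ‖g t‖ ≤ d i)
    {c : Fin p → ℂ} (hc : ∀ s, ‖c s‖ ≤ 1) {x η : ℝ} (hx : x ∈ Set.Ioo 0 (r / p : ℝ))
    (hker : ∀ k < r * m, ‖∑ s, c s * periodization r g (x + s * (r / p) - k / m)‖ ≤ η)
    (N : ℕ) (k : ℤ) :
    ‖fiberSum g r c N (1 / m * k) x‖ ^ 2 ≤ p * (∑' j, d j) *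
      (p * truncationDefect d N (k / (r * m : ℕ)) + window N (k / (r * m : ℕ)) * η) := by
  have hp0 : (0 : ℝ) < p := by exact_mod_cast hp
  have hr0 : (0 : ℝ) < r := by exact_mod_cast hr
  have hm0 : (0 : ℝ) < m := by exact_mod_cast hm
  have hq : (0 : ℤ) < (r * m : ℕ) := by exact_mod_cast Nat.mul_pos hr hm
  set κ : ℤ := k / (r * m : ℕ) with hκ
  obtain ⟨k', hk'⟩ := Int.eq_ofNat_of_zero_le (Int.emod_nonneg k hq.ne')
  have hk'q : k' < r * m := by
    have := Int.emod_lt_of_pos k hq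
    rw [hk'] at this
    exact_mod_cast this
  have hkR : (k : ℝ) = r * m * κ + k' := by
    have := Int.mul_ediv_add_emod k (r * m : ℕ)
    rw [hk', ← hκ] at this
    rw [← this]
    push_cast
    ring
  let a : Fin p → ℤ → ℂ := fun s j => g (x + s * (r / p) - k' / m + r * j)
  have ha : ∀ s j, ‖a s j‖ ≤ d j := fun s j => by
    refine hb _ _ ?_
    have h1 : (0 : ℝ) ≤ k' / m := by positivity
    have h2 : (k' : ℝ) / m ≤ r := by
      rw [div_le_iff₀ hm0]
      exact_mod_cast hk'q.le
    have h3 : (0 : ℝ) ≤ s * (r / p) := by positivity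
    have h4 : ((s : ℕ) + 1 : ℝ) * (r / p) ≤ r := by
      have : ((s : ℕ) + 1 : ℝ) ≤ p := by exact_mod_cast s.2
      calc _ ≤ (p : ℝ) * (r / p) := by gcongr
        _ = r := by field_simp
    rw [add_sub_cancel_right, abs_le]
    constructor <;> linarith [hx.1, hx.2]
  have hfib : fiberSum g r c N (1 / m * k) x =
      ∑ s, c s * ∑ i ∈ Finset.range N, a s (i - κ) := by
    rw [fiberSum, Finset.sum_comm]
    refine Finset.sum_congr rfl fun s _ => ?_
    rw [Finset.mul_sum]
    refine Finset.sum_congr rfl fun i _ => ?_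
    congr 2
    rw [hkR]
    push_cast
    field_simp
    ring
  have hle1 : ‖fiberSum g r c N (1 / m * k) x‖ ≤ p * ∑' j, d j := by
    rw [hfib]
    calc _ ≤ ∑ _s : Fin p, ∑' j, d j := norm_sum_le_of_le _ fun s _ => by
          rw [norm_mul]
          refine (mul_le_of_le_one_left (norm_nonneg _) (hc s)).trans ?_
          refine (norm_sum_le_of_le (Finset.range N) fun (i : ℕ) _ => ha s (i - κ)).trans ?_
          have hinj : Function.Injective fun i : ℕ => (i : ℤ) - κ := fun i i' h => by
            simpa using h
          have := (hd.sum_le_tsum ((Finset.range N).map ⟨_, hinj⟩) fun j _ => hd0 j)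
          rwa [Finset.sum_map] at this
      _ = _ := by simp
  have hle2 : ‖fiberSum g r c N (1 / m * k) x‖ ≤
      p * truncationDefect d N κ + window N κ * η := by
    have hsplit : fiberSum g r c N (1 / m * k) x =
        ∑ s, c s * (∑ i ∈ Finset.range N, a s (i - κ) - window N κ * ∑' j, a s j) +
        window N κ * ∑ s, c s * periodization r g (x + s * (r / p) - k' / m) := by
      rw [hfib, Finset.mul_sum, ← Finset.sum_add_distrib]
      refine Finset.sum_congr rfl fun s _ => ?_
      simp only [periodization, a]
      ring
    rw [hsplit]
    refine (norm_add_le _ _).trans (add_le_add ?_ ?_)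
    · calc _ ≤ ∑ _s : Fin p, truncationDefect d N κ := norm_sum_le_of_le _ fun s _ => by
            rw [norm_mul]
            exact (mul_le_of_le_one_left (norm_nonneg _) (hc s)).trans
              (norm_sum_range_sub_window_mul_tsum_le hd hd0 (ha s) N κ)
        _ = _ := by simp
    · rw [norm_mul, Complex.norm_real, Real.norm_of_nonneg (window_nonneg N κ)]
      exact mul_le_mul_of_nonneg_left (hker k' hk'q) (window_nonneg N κ)
  rw [sq]
  exact mul_le_mul hle1 hle2 (norm_nonneg _) ((norm_nonneg _).trans hle1)

/-! ### Test functions and their Gabor coefficients -/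

/-- Parseval's identity for a bounded function on a subset of `(0, L)`. -/
theorem hasSum_sq_setIntegral_mul_exp {L : ℝ} (hL : 0 < L) {E : Set ℝ} (hE : MeasurableSet E)
    (hEL : E ⊆ Set.Ioo 0 L) {H : ℝ → ℂ} (hH : Measurable H) {C : ℝ} (hC : ∀ x ∈ E, ‖H x‖ ≤ C) :
    HasSum (fun l : ℤ => ‖∫ x in E, H x * Complex.exp (-(2 * Real.pi * Complex.I * l * x / L))‖ ^ 2)
      (L * ∫ x in E, ‖H x‖ ^ 2) := by
  have hEI : Set.Ioc 0 L ∩ E = E :=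
    Set.inter_eq_right.2 (hEL.trans Set.Ioo_subset_Ioc_self)
  have hmem : MemLp (E.indicator H) 2 (volume.restrict (Set.Ioc 0 L)) := by
    refine MemLp.of_bound (hH.indicator hE).aestronglyMeasurable (max C 0)
      (.of_forall fun x => ?_)
    by_cases hx : x ∈ E
    · simp [hx, hC x hx]
    · simp [hx]
  have h := hasSum_sq_fourierCoeffOn hL hmem
  have hcoef : ∀ l : ℤ, fourierCoeffOn hL (E.indicator H) l = (1 / L : ℝ) •
      ∫ x in E, H x * Complex.exp (-(2 * Real.pi * Complex.I * l * x / L)) := fun l => by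
    rw [fourierCoeffOn_eq_integral, sub_zero, intervalIntegral.integral_of_le hL.le]
    congr 1
    have : ∀ x : ℝ, fourier (-l) (x : AddCircle L) • E.indicator H x =
        E.indicator (fun x => H x * Complex.exp (-(2 * Real.pi * Complex.I * l * x / L))) x := by
      intro x
      by_cases hx : x ∈ E
      · rw [Set.indicator_of_mem hx, Set.indicator_of_mem hx, fourier_coe_apply, smul_eq_mul,
          mul_comm]
        congr 2
        push_cast
        ring
      · simp [hx]
    simp only [this]
    rw [setIntegral_indicator hE, hEI]
  have hsq : ∫ x in (0 : ℝ)..L, ‖E.indicator H x‖ ^ 2 = ∫ x in E, ‖H x‖ ^ 2 := by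
    rw [intervalIntegral.integral_of_le hL.le]
    have : ∀ x : ℝ, ‖E.indicator H x‖ ^ 2 = E.indicator (fun x => ‖H x‖ ^ 2) x := fun x => by
      by_cases hx : x ∈ E <;> simp [hx]
    simp only [this]
    rw [setIntegral_indicator hE, hEI]
  rw [hsq] at h
  have h' := h.mul_left (L ^ 2)
  have hl : ∀ l : ℤ, L ^ 2 * ‖fourierCoeffOn hL (E.indicator H) l‖ ^ 2 =
      ‖∫ x in E, H x * Complex.exp (-(2 * Real.pi * Complex.I * l * x / L))‖ ^ 2 := fun l => by
    rw [hcoef, norm_smul, mul_pow, ← mul_assoc, Real.norm_of_nonneg (by positivity), ← mul_pow,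
      mul_one_div_cancel hL.ne', one_pow, one_mul]
  simp only [hl] at h'
  rwa [sub_zero, smul_eq_mul, ← mul_assoc, sq, mul_assoc L L, mul_inv_cancel₀ hL.ne', mul_one]
    at h'

/-- The test function with the value `conj (c s)` on the translates of `E` by
`(s + p * i) * (ρ / p)`, for `s < p` and `i < N`. -/
def testFunction (E : Set ℝ) {p : ℕ} (ρ : ℝ) (c : Fin p → ℂ) (N : ℕ) (t : ℝ) : ℂ :=
  ∑ i ∈ Finset.range N, ∑ s : Fin p,
    E.indicator (fun _ => (starRingEnd ℂ) (c s)) (t - (s * (ρ / p) + ρ * i))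

theorem memLp_testFunction {E : Set ℝ} (hE : MeasurableSet E) (hEfin : volume E ≠ ⊤) {p : ℕ}
    (ρ : ℝ) (c : Fin p → ℂ) (N : ℕ) : MemLp (testFunction E ρ c N) 2 volume := by
  unfold testFunction
  refine memLp_finsetSum _ fun i _ => memLp_finsetSum _ fun s _ => ?_
  exact (memLp_indicator_const 2 hE _ (.inr hEfin)).comp_measurePreserving
    (measurePreserving_sub_right volume _)

/-- Pairing the test function with a Gabor element unfolds into a Fourier coefficient of the fiber
sum, because `exp (2πi (p / ρ) l ·)` has period `ρ / p`. -/
theorem innerL2_testFunction_gaborElement {g : ℝ → ℂ} (hg : Measurable g) {W : ℝ}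
    (hW : ∀ t, ‖g t‖ ≤ W) {E : Set ℝ} (hE : MeasurableSet E) (hEfin : volume E ≠ ⊤) {p : ℕ}
    (hp : 0 < p) {ρ : ℝ} (hρ : 0 < ρ) (c : Fin p → ℂ) (N : ℕ) (α : ℝ) (k l : ℤ) :
    innerL2 (testFunction E ρ c N) (gaborElement g α (p / ρ) k l) =
      ∫ x in E, (starRingEnd ℂ) (fiberSum g ρ c N (α * k) x) *
        Complex.exp (-(2 * Real.pi * Complex.I * l * x / (ρ / p : ℝ))) := by
  let τ : ℕ → Fin p → ℝ := fun i s => s * (ρ / p) + ρ * i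
  let T : ℕ → Fin p → ℝ → ℂ := fun i s x => (starRingEnd ℂ) (c s * g (x + τ i s - α * k)) *
    Complex.exp (-(2 * Real.pi * Complex.I * l * x / (ρ / p : ℝ)))
  have hpC : (p : ℂ) ≠ 0 := by exact_mod_cast hp.ne'
  have hρC : (ρ : ℂ) ≠ 0 := by exact_mod_cast hρ.ne'
  have hT : ∀ i s, IntegrableOn (T i s) E := fun i s => by
    refine Measure.integrableOn_of_bounded (M := ‖c s‖ * W) hEfin ?_ (.of_forall fun x => ?_)
    · have : Measurable fun x => g (x + τ i s - α * k) := hg.comp (by fun_prop)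
      refine Measurable.aestronglyMeasurable ?_
      exact ((Complex.continuous_conj.measurable).comp (this.const_mul (c s))).mul
        (by fun_prop)
    · have h1 : -(2 * (Real.pi : ℂ) * Complex.I * l * x / (ρ / p : ℝ)) =
          ((-(2 * Real.pi * l * x / (ρ / p)) : ℝ) : ℂ) * Complex.I := by
        push_cast
        ring
      simp only [T]
      rw [norm_mul, RCLike.norm_conj, norm_mul, h1, Complex.norm_exp_ofReal_mul_I, mul_one]
      exact mul_le_mul_of_nonneg_left (hW _) (norm_nonneg _)
  have hterm : ∀ i s t, E.indicator (fun _ => (starRingEnd ℂ) (c s)) (t - τ i s) *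
      (starRingEnd ℂ) (gaborElement g α (p / ρ) k l t) = E.indicator (T i s) (t - τ i s) := by
    intro i s t
    by_cases ht : t - τ i s ∈ E
    · rw [Set.indicator_of_mem ht, Set.indicator_of_mem ht]
      have hexp : Complex.exp (-(2 * Real.pi * Complex.I * l * (t - τ i s : ℝ) / (ρ / p : ℝ))) =
          Complex.exp (-(2 * Real.pi * Complex.I * ((p / ρ : ℝ) : ℂ) * l * t)) := by
        rw [Complex.exp_eq_exp_iff_exists_int]
        refine ⟨l * (s + p * i), ?_⟩
        simp only [τ]
        push_cast
        field_simp
        ring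
      simp only [T, hexp, gaborElement, map_mul, ← Complex.exp_conj, sub_add_cancel, map_ofNat,
        Complex.conj_ofReal, Complex.conj_I, map_intCast]
      rw [show -(2 * (Real.pi : ℂ) * Complex.I * ((p / ρ : ℝ) : ℂ) * l * t) =
        2 * Real.pi * -Complex.I * ((p / ρ : ℝ) : ℂ) * l * t by ring]
      ring
    · rw [Set.indicator_of_notMem ht, Set.indicator_of_notMem ht, zero_mul]
  have hint : ∀ i s, Integrable fun t => E.indicator (T i s) (t - τ i s) := fun i s =>
    ((integrable_indicator_iff hE).2 (hT i s)).comp_sub_right _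
  calc innerL2 (testFunction E ρ c N) (gaborElement g α (p / ρ) k l)
      = ∫ t, ∑ i ∈ Finset.range N, ∑ s, E.indicator (T i s) (t - τ i s) := by
        simp only [innerL2, testFunction, Finset.sum_mul]
        simp only [← hterm, τ]
    _ = ∑ i ∈ Finset.range N, ∑ s, ∫ x in E, T i s x := by
        rw [integral_finsetSum _ fun i _ => integrable_finsetSum _ fun s _ => hint i s]
        refine Finset.sum_congr rfl fun i _ => ?_
        rw [integral_finsetSum _ fun s _ => hint i s]
        refine Finset.sum_congr rfl fun s _ => ?_
        rw [integral_sub_right_eq_self (E.indicator (T i s)), integral_indicator hE]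
    _ = ∫ x in E, ∑ i ∈ Finset.range N, ∑ s, T i s x := by
        rw [integral_finsetSum _ fun i _ => integrable_finsetSum _ fun s _ => hT i s]
        refine Finset.sum_congr rfl fun i _ => ?_
        rw [integral_finsetSum _ fun s _ => hT i s]
    _ = _ := by
        simp only [fiberSum, T, τ, map_sum, Finset.sum_mul]

theorem le_integral_sq_norm_testFunction {E : Set ℝ} (hE : MeasurableSet E) {p : ℕ} (hp : 0 < p)
    {ρ : ℝ} (hρ : 0 < ρ) (hEρ : E ⊆ Set.Ioo 0 (ρ / p)) {c : Fin p → ℂ} {s₀ : Fin p}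
    (hs₀ : ‖c s₀‖ = 1) (N : ℕ) :
    N * volume.real E ≤ ∫ t, ‖testFunction E ρ c N t‖ ^ 2 := by
  have hp0 : (0 : ℝ) < p := by exact_mod_cast hp
  have hEfin : volume E ≠ ⊤ := measure_ne_top_of_subset hEρ (by simp)
  have huniq : ∀ {t : ℝ} {i i' : ℕ} {s s' : Fin p}, t - (s * (ρ / p) + ρ * i) ∈ E →
      t - (s' * (ρ / p) + ρ * i') ∈ E → i = i' ∧ s = s' := by
    intro t i i' s s' h h'
    have h1 := hEρ h
    have h2 := hEρ h'
    have hL : 0 < ρ / p := div_pos hρ hp0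
    have hρL : ρ = p * (ρ / p) := by field_simp
    generalize ρ / p = L at *
    subst hρL
    have h3 : (((s : ℕ) + p * i : ℕ) : ℝ) < ((s' : ℕ) + p * i' : ℕ) + 1 := by
      push_cast
      refine lt_of_mul_lt_mul_right ?_ hL.le
      nlinarith [h1.1, h2.2]
    have h4 : (((s' : ℕ) + p * i' : ℕ) : ℝ) < ((s : ℕ) + p * i : ℕ) + 1 := by
      push_cast
      refine lt_of_mul_lt_mul_right ?_ hL.le
      nlinarith [h2.1, h1.2]
    have h5 : (s : ℕ) + p * i = s' + p * i' := by
      have h3' : (s : ℕ) + p * i < s' + p * i' + 1 := by exact_mod_cast h3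
      have h4' : (s' : ℕ) + p * i' < s + p * i + 1 := by exact_mod_cast h4
      omega
    have hm := congrArg (· % p) h5
    have hd := congrArg (· / p) h5
    simp only [Nat.add_mul_mod_self_left, Nat.mod_eq_of_lt s.2, Nat.mod_eq_of_lt s'.2] at hm
    simp only [Nat.add_mul_div_left _ _ hp, Nat.div_eq_of_lt s.2, Nat.div_eq_of_lt s'.2,
      zero_add] at hd
    exact ⟨hd, Fin.ext hm⟩
  have hpt : ∀ t, ∑ i ∈ Finset.range N,
      E.indicator (fun _ => (1 : ℝ)) (t - (s₀ * (ρ / p) + ρ * i)) ≤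
        ‖testFunction E ρ c N t‖ ^ 2 := by
    intro t
    by_cases h : ∃ i ∈ Finset.range N, t - (s₀ * (ρ / p) + ρ * i) ∈ E
    · obtain ⟨i, hi, hit⟩ := h
      rw [Finset.sum_eq_single_of_mem i hi fun i' _ hne => Set.indicator_of_notMem
        (fun h' => hne (huniq h' hit).1) _, Set.indicator_of_mem hit, testFunction,
        Finset.sum_eq_single_of_mem i hi fun i' _ hne => Finset.sum_eq_zero fun s _ =>
          Set.indicator_of_notMem (fun h' => hne (huniq h' hit).1) _,
        Finset.sum_eq_single_of_mem s₀ (Finset.mem_univ _) fun s _ hne =>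
          Set.indicator_of_notMem (fun h' => hne (huniq h' hit).2) _,
        Set.indicator_of_mem hit, RCLike.norm_conj, hs₀, one_pow]
    · push Not at h
      rw [Finset.sum_eq_zero fun i hi => Set.indicator_of_notMem (h i hi) _]
      positivity
  have hI : ∀ i : ℕ, Integrable fun t =>
      E.indicator (fun _ => (1 : ℝ)) (t - (s₀ * (ρ / p) + ρ * i)) := fun i =>
    ((integrable_indicator_iff hE).2 (integrableOn_const hEfin)).comp_sub_right _
  have hsq : Integrable fun t => ‖testFunction E ρ c N t‖ ^ 2 :=
    (memLp_testFunction hE hEfin ρ c N).integrable_norm_pow two_ne_zero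
  refine le_of_eq_of_le ?_ (integral_mono (integrable_finsetSum _ fun i _ => hI i) hsq hpt)
  rw [integral_finsetSum _ fun i _ => hI i]
  simp [integral_sub_right_eq_self (E.indicator fun _ => (1 : ℝ)), integral_indicator hE]

/-! ### Failure of the lower frame bound -/

/-- The part of the theorem that is independent of the choice of representative: for measurable
`g` with amalgam bounds everywhere, an almost everywhere partition of unity rules out the lower
frame bound. -/
theorem not_isGaborFrame_of_ae_partitionOfUnity {g : ℝ → ℂ} (hg : Measurable g) {p m r : ℕ}
    (hr : 0 < r) (hm : 0 < m) (hp : (r - 1) * m + 1 < p) {d : ℤ → ℝ} (hd : Summable d)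
    (hd0 : ∀ i, 0 ≤ d i) (hb : ∀ t : ℝ, ∀ i : ℤ, |t - r * i| ≤ r → ‖g t‖ ≤ d i)
    (hpu : ∀ᵐ x : ℝ, HasSum (fun s : ℤ => g (x - s)) 1) :
    ¬ IsGaborFrame g (1 / m) (p / r) := by
  rintro ⟨A, B, hA, -, hframe⟩
  have hpN : 0 < p := Nat.zero_lt_of_lt hp
  have hp0 : (0 : ℝ) < p := by exact_mod_cast hpN
  have hr0 : (0 : ℝ) < r := by exact_mod_cast hr
  have hq : 0 < r * m := Nat.mul_pos hr hm
  have hL : (0 : ℝ) < r / p := div_pos hr0 hp0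
  have hW0 : 0 ≤ ∑' j, d j := tsum_nonneg hd0
  have hW : ∀ t, ‖g t‖ ≤ ∑' j, d j := fun t => by
    refine (hb t ⌊t / r⌋ ?_).trans (hd.le_tsum _ fun j _ => hd0 j)
    have h1 := (le_div_iff₀ hr0).1 (Int.floor_le (t / r))
    have h2 := (div_lt_iff₀ hr0).1 (Int.lt_floor_add_one (t / r))
    rw [abs_le]
    constructor <;> linarith
  -- the constant depends neither on `η` nor on `N`
  set C : ℝ := (r / p) * ((r * m : ℕ) * (p * ∑' j, d j)) with hC
  have hC0 : 0 ≤ C := by positivity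
  have key : ∀ η > 0, ∀ N : ℕ, A * N ≤ C * (p * totalDefect d N + N * η) := by
    intro η hη N
    obtain ⟨E, hEL, hE, hE0, c, hc, ⟨s₀, hs₀⟩, hker⟩ := exists_approximate_kernel hg hr hm hp
      (summable_periodization hr0 hd hb) hpu hη
    have hEfin : volume E ≠ ⊤ := measure_ne_top_of_subset hEL (by simp)
    have hEpos : 0 < volume.real E := ENNReal.toReal_pos hE0 hEfin
    let D : ℤ → ℝ := fun κ => p * (∑' j, d j) *
      (p * truncationDefect d N κ + window N κ * η)
    have hD0 : ∀ κ, 0 ≤ D κ := fun κ => by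
      have h1 := truncationDefect_nonneg hd0 N κ
      have h2 := window_nonneg N κ
      positivity
    have hDsum : ∀ K : Finset ℤ, ∑ κ ∈ K, D κ ≤
        p * (∑' j, d j) * (p * totalDefect d N + N * η) := fun K => by
      simp only [D]
      rw [← Finset.mul_sum, Finset.sum_add_distrib, ← Finset.mul_sum, ← Finset.sum_mul]
      have h1 := sum_truncationDefect_le hd hd0 N K
      have h2 := sum_window_le N K
      gcongr
    have hDb : ∀ (k : ℤ), ∀ x ∈ E, ‖fiberSum g r c N (1 / m * k) x‖ ^ 2 ≤ D (k / (r * m : ℕ)) :=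
      fun k x hx => sq_norm_fiberSum_le hr hm hpN hd hd0 hb hc (hEL hx) (hker x hx) N k
    obtain ⟨hsumm, hlow, -⟩ := hframe (testFunction E r c N) (memLp_testFunction hE hEfin r c N)
    have hrow : ∀ k : ℤ, ∑' l : ℤ, ‖innerL2 (testFunction E r c N)
        (gaborElement g (1 / m) (p / r) k l)‖ ^ 2 ≤
          (r / p) * (volume.real E * D (k / (r * m : ℕ))) := by
      intro k
      simp only [innerL2_testFunction_gaborElement hg hW hE hEfin hpN hr0 c N]
      have hmeas := measurable_fiberSum hg r c N (1 / m * k)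
      rw [(hasSum_sq_setIntegral_mul_exp hL hE hEL (C := √(D (k / (r * m : ℕ))))
        (H := fun x => (starRingEnd ℂ) (fiberSum g r c N (1 / m * k) x))
        (Complex.continuous_conj.measurable.comp hmeas) fun x hx => ?_).tsum_eq]
      · refine mul_le_mul_of_nonneg_left ?_ hL.le
        simp only [RCLike.norm_conj]
        rw [mul_comm (volume.real E)]
        refine (le_abs_self _).trans ?_
        rw [← Real.norm_eq_abs]
        refine norm_setIntegral_le_of_norm_le_const (lt_top_iff_ne_top.2 hEfin) fun x hx => ?_
        rw [Real.norm_of_nonneg (by positivity)]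
        exact hDb k x hx
      · rw [RCLike.norm_conj]
        exact Real.le_sqrt_of_sq_le (hDb k x hx)
    have hup : ∑' kl : ℤ × ℤ, ‖innerL2 (testFunction E r c N)
        (gaborElement g (1 / m) (p / r) kl.1 kl.2)‖ ^ 2 ≤
          volume.real E * (C * (p * totalDefect d N + N * η)) := by
      rw [hsumm.tsum_prod]
      refine Real.tsum_le_of_sum_le (fun k => tsum_nonneg fun l => by positivity) fun K => ?_
      calc _ ≤ ∑ k ∈ K, (r / p) * (volume.real E * D (k / (r * m : ℕ))) :=
            Finset.sum_le_sum fun k _ => hrow k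
        _ = (r / p) * (volume.real E * ∑ k ∈ K, D (k / (r * m : ℕ))) := by
            simp only [Finset.mul_sum]
        _ ≤ (r / p) * (volume.real E * ((r * m : ℕ) *
              (p * (∑' j, d j) * (p * totalDefect d N + N * η)))) := by
            have := sum_comp_ediv_le hD0 hDsum hq K
            gcongr
        _ = _ := by rw [hC]; ring
    have hnorm := le_integral_sq_norm_testFunction hE hpN hr0 hEL hs₀ N
    refine le_of_mul_le_mul_left ?_ hEpos
    calc volume.real E * (A * N) = A * (N * volume.real E) := by ring
      _ ≤ A * ∫ t, ‖testFunction E r c N t‖ ^ 2 := by gcongr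
      _ ≤ _ := hlow.trans hup
  have hlim : ∀ η > 0, A ≤ C * η := by
    intro η hη
    have h1 := (((tendsto_totalDefect_div hd hd0).const_mul (p : ℝ)).add_const η).const_mul C
    rw [mul_zero, zero_add] at h1
    refine ge_of_tendsto h1 ?_
    filter_upwards [Filter.eventually_gt_atTop 0] with N hN
    have hN' : (0 : ℝ) < N := by exact_mod_cast hN
    refine le_of_mul_le_mul_right ((key η hη N).trans_eq ?_) hN'
    field_simp
  have h := hlim (A / (C + 1)) (by positivity)
  rw [← mul_div_assoc, le_div_iff₀ (by positivity)] at h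
  linarith

/-- Being a Gabor frame only depends on the almost everywhere class of the window. -/
theorem IsGaborFrame.congr_ae {g g' : ℝ → ℂ} (h : g =ᵐ[volume] g') {α β : ℝ}
    (hf : IsGaborFrame g α β) : IsGaborFrame g' α β := by
  have hinner : ∀ (f : ℝ → ℂ) (k l : ℤ),
      innerL2 f (gaborElement g' α β k l) = innerL2 f (gaborElement g α β k l) := by
    intro f k l
    refine integral_congr_ae ?_
    have h' : ∀ᵐ t : ℝ, g (t - α * k) = g' (t - α * k) :=
      (measurePreserving_sub_right volume (α * k)).quasiMeasurePreserving.ae h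
    filter_upwards [h'] with t ht
    simp only [gaborElement, ht]
  unfold IsGaborFrame at hf ⊢
  simpa only [hinner] using hf

end

theorem proposition2 (g : ℝ → ℂ) (hg : IsFeichtinger g)
    (hpu : IsPartitionOfUnityByTranslates g)
    (m n r j : ℕ) (hj : 1 ≤ j) (hjr : j ≤ r - 1)
    (hlow : (r - 1) * m + 1 < r * n + j) (hup : r * n + j < r * m)
    (hcop : Nat.Coprime (r * n + j) (r * m)) :
    ¬ IsGaborFrame g (1 / (m : ℝ)) ((n : ℝ) + (j : ℝ) / (r : ℝ)) := by
  have hr : 0 < r := by omega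
  have hm : 0 < m := Nat.pos_of_ne_zero fun h => by simp [h] at hup
  have hr0 : (0 : ℝ) < r := by exact_mod_cast hr
  obtain ⟨d, hd, hd0, hgd⟩ := hg.exists_summable_bound hr0
  obtain ⟨g₁, hg₁, hgg₁⟩ := hg.memLp.aestronglyMeasurable
  have hg₁m := hg₁.measurable
  -- a measurable representative of `g`, set to zero where the amalgam bounds fail
  let S : Set ℝ := ⋂ i : ℤ, {t | |t - r * i| ≤ r → ‖g₁ t‖ ≤ d i}
  have hS : MeasurableSet S := MeasurableSet.iInter fun i => by
    refine MeasurableSet.imp ?_ ?_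
    · exact measurableSet_le (by fun_prop) measurable_const
    · exact measurableSet_le hg₁m.norm measurable_const
  let g' : ℝ → ℂ := S.indicator g₁
  have hgg' : g =ᵐ[volume] g' := by
    filter_upwards [hgg₁, hgd] with t h1 h2
    have : t ∈ S := Set.mem_iInter.2 fun i hi => h1 ▸ h2 i hi
    simp only [g', h1, Set.indicator_of_mem this]
  have hb : ∀ t : ℝ, ∀ i : ℤ, |t - r * i| ≤ r → ‖g' t‖ ≤ d i := fun t i hti => by
    by_cases ht : t ∈ S
    · simp only [g', Set.indicator_of_mem ht]
      exact Set.mem_iInter.1 ht i hti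
    · simp only [g', Set.indicator_of_notMem ht, norm_zero]
      exact hd0 i
  have hpu' : ∀ᵐ x : ℝ, HasSum (fun s : ℤ => g' (x - s)) 1 := by
    have : ∀ᵐ x : ℝ, ∀ s : ℤ, g (x - s) = g' (x - s) := ae_all_iff.2 fun s =>
      (measurePreserving_sub_right volume (s : ℝ)).quasiMeasurePreserving.ae hgg'
    filter_upwards [this] with x hx
    simpa only [hx] using hpu x
  have hβ : (n : ℝ) + j / r = (r * n + j : ℕ) / r := by
    push_cast
    field_simp
  rw [hβ]
  exact fun hf => not_isGaborFrame_of_ae_partitionOfUnity (hg₁m.indicator hS) hr hm hlow hd hd0 hb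
    hpu' (hf.congr_ae hgg')
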